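/- Let $(X,d)$ be an infinite metric space and let $\mathfrak{B}$ be a bornology on $X$, that is, a hereditary family of subsets of $X$ that is closed under finite unions and covers $X$; assume that $X\notin\mathfrak{B}$ and that $\mathfrak{B}$ has a compact base, i.e. there is a subfamily $\mathfrak{B}_0\subseteq\mathfrak{B}$ of compact sets such that every $B\in\mathfrak{B}$ is contained in some $B_0\in\mathfrak{B}_0$. Notation. For $B\subseteq X$ and $\delta>0$ let $B^\delta=\bigcup_{x\in B}\{y\in X: d(x,y)<\delta\}$. For classes $\mathcal{A},\mathcal{C}$ of subsets of a set $S$, $S_1(\mathcal{A},\mathcal{C})$ means: for every sequence $(A_n)_{n\in\mathbb{N}}$ of elements of $\mathcal{A}$ there are $b_n\in A_n$ with $\{b_n:n\in\mathbb{N}\}\in\mathcal{C}$. An open $\mathfrak{B}^s$-cover of $X$ is an open cover $\mathcal{U}$ of $X$ with $X\notin\mathcal{U}$ such that for each $B\in\mathfrak{B}$ there are $U\in\mathcal{U}$ and $\delta>0$ with $B^\delta\subseteq U$. An open cover $\mathcal{U}$ of $X$ is $\mathfrak{B}^s$-groupable if $\mathcal{U}=\bigcup_{n\in\mathbb{N}}\mathcal{U}_n$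 with finite, pairwise disjoint $\mathcal{U}_n$ such that for each $B\in\mathfrak{B}$ there is $n_0$ such that for all $n\ge n_0$ there are $U\in\mathcal{U}_n$ and $\delta>0$ with $B^\delta\subseteq U$. Write $\mathcal{O}_{\mathfrak{B}^s}$ for the class of open $\mathfrak{B}^s$-covers and $\mathcal{O}^{gp}_{\mathfrak{B}^s}$ for the class of $\mathfrak{B}^s$-groupable open covers. $X$ has the $\mathfrak{B}^s$-Gerlits–Nagy property if $S_1(\mathcal{O}_{\mathfrak{B}^s},\mathcal{O}^{gp}_{\mathfrak{B}^s})$ holds. For $n\ge 1$, $X^n$ carries the metric $\max_i d(x_i,y_i)$ and $\mathfrak{B}^n$ is the bornology on $X^n$ generated by $\{B^n:B\in\mathfrak{B}\}$; the same definitions are applied to $(X^n,\mathfrak{B}^n)$. Let $C(X)$ be the set of continuous functions $X\to\mathbb{R}$, and let $\tau^s_{\mathfrak{B}}$ be the topology of strong uniform convergence on $\mathfrak{B}$: the topology on $C(X)$ induced by the uniformity on $\mathbb{R}^X$ with base the sets $[B,\varepsilon]^s=\{(f,g):\exists\delta>0\ \forall x\in B^\delta,\ |f(x)-g(x)|<\varepsilon\}$,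 where $B\in\mathfrak{B}$, $\varepsilon>0$. For a point $y$ of a topological space $Y$ put $\Omega_y=\{A\subseteq Y: y\in\overline{A}\setminus A\}$. $Y$ has countable strong fan tightness if $S_1(\Omega_y,\Omega_y)$ holds for every $y\in Y$. $Y$ has Reznichenko's property if for every $y\in Y$ every countable $A\in\Omega_y$ is a union $\bigcup_{n\in\mathbb{N}}A_n$ of pairwise disjoint finite sets such that every neighbourhood of $y$ meets $A_n$ for all but finitely many $n$. Statement. The following are equivalent: (1) $X^n$ has the $(\mathfrak{B}^n)^s$-Gerlits–Nagy property for every integer $n\ge 1$. (2) $(C(X),\tau^s_{\mathfrak{B}})$ has countable strong fan tightness and Reznichenko's property. -/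

import Mathlib

open Set Filter Topology

/-- The family of sets that belong to a bornology. A `Bornology X` of Mathlib is a hereditary family
of subsets of `X`, closed under finite unions, that covers `X`. It is passed explicitly everywhere,
since it has nothing to do with the metrically bounded sets of a metric space `X`. -/
def bornSets {X : Type*} (𝔅 : Bornology X) : Set (Set X) :=
  {B | @Bornology.IsBounded X 𝔅 B}

/-- `𝔅₀` is a base of the bornology `𝔅`: a cofinal subfamily of `𝔅`. -/
def IsBornBase {X : Type*} (𝔅 : Bornology X) (𝔅₀ : Set (Set X)) : Prop :=
  𝔅₀ ⊆ bornSets 𝔅 ∧ ∀ B ∈ bornSets 𝔅, ∃ B₀ ∈ 𝔅₀, B ⊆ B₀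

/-- `𝔅` has a compact base. -/
def HasCompactBase {X : Type*} [TopologicalSpace X] (𝔅 : Bornology X) : Prop :=
  ∃ 𝔅₀ : Set (Set X), IsBornBase 𝔅 𝔅₀ ∧ ∀ B ∈ 𝔅₀, IsCompact B

/-- The cube `B^n` in `X^n`. -/
def cube {X : Type*} (n : ℕ) (B : Set X) : Set (Fin n → X) :=
  {x | ∀ i, x i ∈ B}

/-- The bornology `𝔅^n` on `X^n` that is generated by the cubes `B^n`, `B ∈ 𝔅`. -/
@[reducible] def powBornology {X : Type*} (𝔅 : Bornology X) (n : ℕ) : Bornology (Fin n → X) :=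
  Bornology.ofBounded {S | ∃ B ∈ bornSets 𝔅, S ⊆ cube n B}
    ⟨∅, @Bornology.isBounded_empty X 𝔅, empty_subset _⟩
    (fun _ ⟨B, hB, h⟩ _ hs => ⟨B, hB, hs.trans h⟩)
    (fun _ ⟨B, hB, h⟩ _ ⟨C, hC, k⟩ => ⟨B ∪ C, @Bornology.IsBounded.union X 𝔅 _ _ hB hC,
      union_subset (fun _ hx i => Or.inl (h hx i)) (fun _ hx i => Or.inr (k hx i))⟩)
    (fun x => ⟨range x, @Set.Finite.isBounded X 𝔅 _ (finite_range x),
      fun _ hy i => ⟨i, (congrFun (mem_singleton_iff.mp hy) i).symm⟩⟩)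

/-- The selection principle `S₁(𝒜, ℬ)` for classes `𝒜`, `ℬ` of subsets of `S`. -/
def SelOne {S : Type*} (𝒜 ℬ : Set (Set S)) : Prop :=
  ∀ A : ℕ → Set S, (∀ n, A n ∈ 𝒜) → ∃ b : ℕ → S, (∀ n, b n ∈ A n) ∧ range b ∈ ℬ

/-- `𝒰` is an open cover of `X`. -/
def IsOpenCovering {X : Type*} [TopologicalSpace X] (𝒰 : Set (Set X)) : Prop :=
  (∀ U ∈ 𝒰, IsOpen U) ∧ ⋃₀ 𝒰 = univ

/-- The class of open `𝔅^s`-covers of `X`. Here `Metric.thickening δ B` is the union `B^δ` of the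
open balls of radius `δ` around the points of `B`. -/
def openStrongCovers {X : Type*} [MetricSpace X] (𝔅 : Bornology X) : Set (Set (Set X)) :=
  {𝒰 | IsOpenCovering 𝒰 ∧ univ ∉ 𝒰 ∧
    ∀ B ∈ bornSets 𝔅, ∃ U ∈ 𝒰, ∃ δ : ℝ, 0 < δ ∧ Metric.thickening δ B ⊆ U}

/-- The class of `𝔅^s`-groupable open covers of `X`. -/
def groupableCovers {X : Type*} [MetricSpace X] (𝔅 : Bornology X) : Set (Set (Set X)) :=
  {𝒰 | IsOpenCovering 𝒰 ∧ ∃ 𝒲 : ℕ → Set (Set X),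
    (∀ n, (𝒲 n).Finite) ∧ (∀ m n, m ≠ n → Disjoint (𝒲 m) (𝒲 n)) ∧ 𝒰 = ⋃ n, 𝒲 n ∧
    ∀ B ∈ bornSets 𝔅, ∃ n₀, ∀ n ≥ n₀,
      ∃ U ∈ 𝒲 n, ∃ δ : ℝ, 0 < δ ∧ Metric.thickening δ B ⊆ U}

/-- The `𝔅^s`-Gerlits–Nagy property of `X`, that is, `S₁(𝒪_{𝔅^s}, 𝒪_{𝔅^s}^{gp})`. -/
def HasGerlitsNagy (X : Type*) [MetricSpace X] (𝔅 : Bornology X) : Prop :=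
  SelOne (openStrongCovers 𝔅) (groupableCovers 𝔅)

/-- The basic entourage `[B, ε]^s` of the uniformity of strong uniform convergence on `X → Y`. -/
def strongEntourage {X Y : Type*} [MetricSpace X] [MetricSpace Y] (B : Set X) (ε : ℝ) :
    Set ((X → Y) × (X → Y)) :=
  {p | ∃ δ : ℝ, 0 < δ ∧ ∀ x ∈ Metric.thickening δ B, dist (p.1 x) (p.2 x) < ε}

/-- The filter basis of all `[B, ε]^s`, `B ∈ 𝔅`, `ε > 0`. -/
def strongBasis {X : Type*} (Y : Type*) [MetricSpace X] [MetricSpace Y] (𝔅 : Bornology X) :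
    FilterBasis ((X → Y) × (X → Y)) where
  sets := {E | ∃ B ∈ bornSets 𝔅, ∃ ε : ℝ, 0 < ε ∧ E = strongEntourage B ε}
  nonempty := ⟨_, ∅, @Bornology.isBounded_empty X 𝔅, 1, one_pos, rfl⟩
  inter_sets := by
    rintro _ _ ⟨B, hB, ε, hε, rfl⟩ ⟨C, hC, η, hη, rfl⟩
    refine ⟨_, ⟨B ∪ C, @Bornology.IsBounded.union X 𝔅 _ _ hB hC, min ε η, lt_min hε hη, rfl⟩, ?_⟩
    rintro p ⟨δ, hδ, h⟩
    exact ⟨⟨δ, hδ, fun x hx => (h x (Metric.thickening_subset_of_subset δ subset_union_left hx)).trans_le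
        (min_le_left _ _)⟩,
      ⟨δ, hδ, fun x hx => (h x (Metric.thickening_subset_of_subset δ subset_union_right hx)).trans_le
        (min_le_right _ _)⟩⟩

/-- The uniformity of strong uniform convergence on `𝔅`, on the set of all functions `X → Y`. -/
@[reducible] def strongUniformSpace {X : Type*} (Y : Type*) [MetricSpace X] [MetricSpace Y]
    (𝔅 : Bornology X) : UniformSpace (X → Y) :=
  UniformSpace.ofCore <| UniformSpace.Core.mkOfBasis (strongBasis Y 𝔅)
    (by
      rintro _ ⟨B, hB, ε, hε, rfl⟩ f
      exact ⟨1, one_pos, fun x _ => by simpa using hε⟩)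
    (by
      rintro _ ⟨B, hB, ε, hε, rfl⟩
      refine ⟨_, ⟨B, hB, ε, hε, rfl⟩, ?_⟩
      rintro p ⟨δ, hδ, h⟩
      exact ⟨δ, hδ, fun x hx => by simpa [dist_comm] using h x hx⟩)
    (by
      rintro _ ⟨B, hB, ε, hε, rfl⟩
      refine ⟨_, ⟨B, hB, ε / 2, half_pos hε, rfl⟩, ?_⟩
      rintro ⟨f, g⟩ ⟨k, ⟨δ, hδ, h⟩, ⟨η, hη, h'⟩⟩
      refine ⟨min δ η, lt_min hδ hη, fun x hx => ?_⟩
      have h1 := h x (Metric.thickening_mono (min_le_left _ _) B hx)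
      have h2 := h' x (Metric.thickening_mono (min_le_right _ _) B hx)
      have h3 := dist_triangle (f x) (k x) (g x)
      simp only at h1 h2 ⊢
      linarith)

/-- The set `C(X)` of continuous real functions on `X`, to be equipped with the topology of strong
uniform convergence on `𝔅` (and not with the compact-open topology of `C(X, ℝ)`). -/
def StrongC {X : Type*} [MetricSpace X] (_𝔅 : Bornology X) : Type _ := C(X, ℝ)

/-- The topology `τ^s_𝔅` of strong uniform convergence on `𝔅`, on `C(X)`. -/
instance {X : Type*} [MetricSpace X] (𝔅 : Bornology X) : TopologicalSpace (StrongC 𝔅) :=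
  TopologicalSpace.induced (fun f : C(X, ℝ) => (f : X → ℝ))
    (strongUniformSpace ℝ 𝔅).toTopologicalSpace

/-- `Ω_y`, the class of all sets `A` with `y ∈ closure A \ A`. -/
def OmegaAt {Y : Type*} [TopologicalSpace Y] (y : Y) : Set (Set Y) :=
  {A | y ∈ closure A \ A}

/-- Countable strong fan tightness (at every point). -/
def HasCountableStrongFanTightness (Y : Type*) [TopologicalSpace Y] : Prop :=
  ∀ y : Y, SelOne (OmegaAt y) (OmegaAt y)

/-- Reznichenko's property (at every point). -/
def HasReznichenko (Y : Type*) [TopologicalSpace Y] : Prop :=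
  ∀ y : Y, ∀ A ∈ OmegaAt y, A.Countable → ∃ P : ℕ → Set Y,
    (∀ n, (P n).Finite) ∧ (∀ m n, m ≠ n → Disjoint (P m) (P n)) ∧ A = ⋃ n, P n ∧
    ∀ W ∈ 𝓝 y, ∃ n₀, ∀ n ≥ n₀, (W ∩ P n).Nonempty

/-!
The proof passes through a selection property `GroupedSelection 𝔅` in which the selected sets are
*indexed*: from every sequence of `𝔅`-covers one can select `b m ∈ 𝒰 m` and pairwise disjoint finite
sets of indices `I n ⊆ ℕ` such that each `B ∈ 𝔅` is, for all large `n`, contained in some `b m` with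
`m ∈ I n`.

Since `𝔅` has a compact base, an open set that contains a bounded compact set contains a thickening
of it. So the strong covers are the open families, without the whole space, in which every
`B ∈ 𝔅` is contained in a member (`mem_openStrongCovers_iff`), and the topology `τ^s_𝔅` on `C(X)` is
that of uniform convergence on the members of `𝔅` (`StrongC.mem_nhds_iff`).

The indexed property is equivalent to the Gerlits–Nagy property. A groupable selection can be
indexed by choosing one index for each selected set (`exists_index_groups`). Conversely,
repetitions among the `b m` have to be removed to get disjoint groups. They are harmless if the
covers are chosen well: finitely many members can be deleted from a countable cover, so one may
select from the covers `{U j | j ≥ m}`, and then far apart groups of indices name disjoint sets of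
members (`exists_regrouping`). Hence every countable cover is groupable, in particular the one that
is selected from a given sequence.

The indexed property passes from `X` to `X^n`, because by the tube lemma an open set containing
`K^n` contains some `V^n` with `V ⊇ K` open (`GroupedSelection.pow`), and it passes from `X^1` back
to `X`. Finally it is equivalent to the conjunction of the two properties of `C(X)`. In one
direction, each cover is coded by the functions that are at distance at least `1` from `0` outside
a member of the cover, which cluster at `0` by Urysohn's lemma. In the other, a set `A` of functions
clustering at `y` is coded by the covers consisting of sets on which some `f ∈ A` is
`1 / (m + 1)`-close to `y`, and `exists_regrouping` again makes the groups disjoint.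
-/

/-! ### Groups of indices -/

/-- Groups of values of a sequence are images of groups of indices. -/
lemma exists_index_groups {α : Type*} {b : ℕ → α} {W : ℕ → Set α}
    (hfin : ∀ n, (W n).Finite) (hdisj : ∀ m n, m ≠ n → Disjoint (W m) (W n))
    (hsub : ∀ n, W n ⊆ range b) :
    ∃ I : ℕ → Set ℕ, (∀ n, (I n).Finite) ∧ (∀ m n, m ≠ n → Disjoint (I m) (I n)) ∧
      ∀ n, b '' I n = W n := by
  have hg : ∀ u ∈ range b, b (Function.invFun b u) = u := fun u hu => Function.invFun_eq hu
  refine ⟨fun n => Function.invFun b '' W n, fun n => (hfin n).image _, ?_, ?_⟩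
  · intro m n hmn
    rw [Set.disjoint_left]
    rintro _ ⟨u, hu, rfl⟩ ⟨v, hv, huv⟩
    have huv' : u = v := by rw [← hg u (hsub m hu), ← hg v (hsub n hv), huv]
    exact Set.disjoint_left.mp (hdisj m n hmn) hu (huv' ▸ hv)
  · intro n
    rw [image_image]
    exact (image_congr fun u hu => hg u (hsub n hu)).trans (image_id' _)

/-- Pairwise disjoint sets of natural numbers move off to infinity. -/
lemma eventually_forall_le_of_disjoint {I : ℕ → Set ℕ}
    (hdisj : ∀ m n, m ≠ n → Disjoint (I m) (I n)) (N : ℕ) :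
    ∀ᶠ n in atTop, ∀ m ∈ I n, N ≤ m := by
  have h : ∀ i < N, ∀ᶠ n in atTop, i ∉ I n := by
    intro i _
    by_cases hi : ∃ k, i ∈ I k
    · obtain ⟨k, hk⟩ := hi
      filter_upwards [eventually_gt_atTop k] with n hn
      exact Set.disjoint_left.mp (hdisj k n hn.ne) hk
    · push Not at hi
      exact Eventually.of_forall hi
  filter_upwards [(eventually_all_finite (Set.finite_lt_nat N)).mpr h] with n hn m hm
  by_contra! hlt
  exact hn m hlt hm

/-- If the sequence `b` in the countable set `A` visits late elements of `A` only, then `A` can be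
partitioned into finite sets that contain the values of `b` on a subsequence of given groups of
indices. The countability of `A` is witnessed by `e`. -/
lemma exists_regrouping {α : Type*} {A : Set α} {e : α → ℕ} (he : InjOn e A) {b : ℕ → α}
    (hb : ∀ m, b m ∈ A) (hbe : ∀ m, m ≤ e (b m)) {I : ℕ → Set ℕ} (hfin : ∀ n, (I n).Finite)
    (hdisj : ∀ m n, m ≠ n → Disjoint (I m) (I n)) :
    ∃ (P : ℕ → Set α) (s : ℕ → ℕ), StrictMono s ∧ (∀ n, (P n).Finite) ∧
      (∀ m n, m ≠ n → Disjoint (P m) (P n)) ∧ A = ⋃ n, P n ∧ ∀ n, b '' I (s n) ⊆ P n := by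
  obtain ⟨s, -, hs⟩ := exists_seq_of_forall_finset_exists (fun _ : ℕ => True)
    (fun k l => k < l ∧ ∀ i ∈ I k, ∀ j ∈ I l, e (b i) < e (b j)) (by
      intro t _
      have h : ∀ k ∈ t, ∀ᶠ l in atTop, k < l ∧ ∀ i ∈ I k, ∀ j ∈ I l, e (b i) < e (b j) := by
        intro k _
        obtain ⟨N, hN⟩ := ((hfin k).image fun i => e (b i)).bddAbove
        filter_upwards [eventually_gt_atTop k, eventually_forall_le_of_disjoint hdisj (N + 1)]
          with l hl hl'
        refine ⟨hl, fun i hi j hj => ?_⟩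
        have h1 : e (b i) ≤ N := hN ⟨i, hi, rfl⟩
        have h2 := hl' j hj
        have h3 := hbe j
        omega
      obtain ⟨l, hl⟩ := ((Filter.eventually_all_finset t).mpr h).exists
      exact ⟨l, trivial, hl⟩)
  have key : ∀ m n, m < n → Disjoint (b '' I (s m)) (b '' I (s n)) := by
    intro m n hmn
    rw [Set.disjoint_left]
    rintro _ ⟨i, hi, rfl⟩ ⟨j, hj, hij⟩
    exact ((hs m n hmn).2 i hi j hj).ne (by rw [hij])
  -- The elements of `A` that lie in no chosen group are distributed one by one.
  refine ⟨fun n => b '' I (s n) ∪ {a ∈ A | e a = n ∧ ∀ k, a ∉ b '' I (s k)}, s,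
    fun m n hmn => (hs m n hmn).1, fun n => ((hfin _).image b).union ?_, ?_, ?_,
    fun n => subset_union_left⟩
  · exact Set.Subsingleton.finite fun x hx y hy => he hx.1 hy.1 (hx.2.1.trans hy.2.1.symm)
  · intro m n hmn
    rw [Set.disjoint_left]
    rintro x (hx | hx) (hy | hy)
    · rcases hmn.lt_or_gt with h | h
      · exact Set.disjoint_left.mp (key m n h) hx hy
      · exact Set.disjoint_left.mp (key n m h) hy hx
    · exact hy.2.2 m hx
    · exact hx.2.2 n hy
    · exact hmn (hx.2.1.symm.trans hy.2.1)
  · ext x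
    simp only [mem_iUnion]
    constructor
    · intro hx
      by_cases h : ∃ k, x ∈ b '' I (s k)
      · exact h.imp fun k hk => Or.inl hk
      · push Not at h
        exact ⟨e x, Or.inr ⟨hx, rfl, h⟩⟩
    · rintro ⟨n, ⟨i, -, rfl⟩ | hx⟩
      · exact hb i
      · exact hx.1

/-! ### Covers with respect to a bornology with compact base -/

/-- `𝒰` is an open `𝔅`-cover: the whole space is not a member of `𝒰`, and each `B ∈ 𝔅` is contained
in a member. No thickening of `B` is asked for. That `𝒰` covers is automatic, since singletons belong
to `𝔅`. -/
structure IsBornCover {X : Type*} [TopologicalSpace X] (𝔅 : Bornology X) (𝒰 : Set (Set X)) :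
    Prop where
  isOpen : ∀ U ∈ 𝒰, IsOpen U
  univ_notMem : univ ∉ 𝒰
  exists_subset : ∀ B ∈ bornSets 𝔅, ∃ U ∈ 𝒰, B ⊆ U

/-- Every sequence of `𝔅`-covers has a selection `b` and pairwise disjoint finite groups `I n` of
indices such that each `B ∈ 𝔅` is contained, for all large `n`, in a set selected at an index in
`I n`. The selected sets may repeat. -/
def GroupedSelection {X : Type*} [TopologicalSpace X] (𝔅 : Bornology X) : Prop :=
  ∀ 𝒰 : ℕ → Set (Set X), (∀ m, IsBornCover 𝔅 (𝒰 m)) →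
    ∃ (b : ℕ → Set X) (I : ℕ → Set ℕ), (∀ m, b m ∈ 𝒰 m) ∧ (∀ n, (I n).Finite) ∧
      (∀ m n, m ≠ n → Disjoint (I m) (I n)) ∧
      ∀ B ∈ bornSets 𝔅, ∀ᶠ n in atTop, ∃ m ∈ I n, B ⊆ b m

section bornSets

variable {X : Type*} {𝔅 : Bornology X} {B C : Set X}

lemma bornSets_union (hB : B ∈ bornSets 𝔅) (hC : C ∈ bornSets 𝔅) : B ∪ C ∈ bornSets 𝔅 :=
  @Bornology.IsBounded.union X 𝔅 _ _ hB hC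

lemma bornSets_finite (hB : B.Finite) : B ∈ bornSets 𝔅 := @Set.Finite.isBounded X 𝔅 _ hB

lemma bornSets_subset (hC : C ∈ bornSets 𝔅) (h : B ⊆ C) : B ∈ bornSets 𝔅 :=
  @Bornology.IsBounded.subset X 𝔅 _ _ hC h

lemma exists_notMem_of_mem_bornSets (hX : univ ∉ bornSets 𝔅) (hB : B ∈ bornSets 𝔅) :
    ∃ x, x ∉ B := by
  by_contra! h
  exact hX (eq_univ_of_forall h ▸ hB)

lemma HasCompactBase.exists_isCompact [TopologicalSpace X] (hc : HasCompactBase 𝔅)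
    (hB : B ∈ bornSets 𝔅) : ∃ K ∈ bornSets 𝔅, IsCompact K ∧ B ⊆ K := by
  obtain ⟨𝔅₀, h, hK⟩ := hc
  obtain ⟨K, hK₀, hBK⟩ := h.2 B hB
  exact ⟨K, h.1 hK₀, hK K hK₀, hBK⟩

lemma sUnion_eq_univ_of_bornSets {𝒰 : Set (Set X)}
    (h : ∀ B ∈ bornSets 𝔅, ∃ U ∈ 𝒰, B ⊆ U) : ⋃₀ 𝒰 = univ := by
  refine eq_univ_of_forall fun x => ?_
  obtain ⟨U, hU, hxU⟩ := h {x} (bornSets_finite (finite_singleton x))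
  exact ⟨U, hU, hxU rfl⟩

end bornSets

section Covers

variable {X : Type*} [MetricSpace X] {𝔅 : Bornology X}

lemma mem_openStrongCovers_iff (hc : HasCompactBase 𝔅) {𝒰 : Set (Set X)} :
    𝒰 ∈ openStrongCovers 𝔅 ↔ IsBornCover 𝔅 𝒰 := by
  constructor
  · rintro ⟨h1, h2, h3⟩
    refine ⟨h1.1, h2, fun B hB => ?_⟩
    obtain ⟨U, hU, δ, hδ, h⟩ := h3 B hB
    exact ⟨U, hU, (Metric.self_subset_thickening hδ B).trans h⟩
  · rintro ⟨h1, h2, h3⟩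
    refine ⟨⟨h1, sUnion_eq_univ_of_bornSets h3⟩, h2, fun B hB => ?_⟩
    obtain ⟨K, hK, hKc, hBK⟩ := hc.exists_isCompact hB
    obtain ⟨U, hU, hKU⟩ := h3 K hK
    obtain ⟨δ, hδ, h⟩ := hKc.exists_thickening_subset_open (h1 U hU) hKU
    exact ⟨U, hU, δ, hδ, (Metric.thickening_subset_of_subset δ hBK).trans h⟩

/-- Finitely many members can be deleted from a `𝔅`-cover: add to `B` a point outside each of
them. -/
lemma IsBornCover.exists_subset_notMem {𝒰 F : Set (Set X)} (h : IsBornCover 𝔅 𝒰) (hF : F.Finite)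
    (hFU : F ⊆ 𝒰) {B : Set X} (hB : B ∈ bornSets 𝔅) : ∃ U ∈ 𝒰, U ∉ F ∧ B ⊆ U := by
  have hx : ∀ U : Set X, ∃ x, U ∈ F → x ∉ U := by
    intro U
    by_cases hU : U ∈ F
    · obtain ⟨x, hx⟩ := (ne_univ_iff_exists_notMem U).mp
        fun h' => h.univ_notMem (h' ▸ hFU hU)
      exact ⟨x, fun _ => hx⟩
    · obtain ⟨U', hU', -⟩ := h.exists_subset ∅ (bornSets_finite finite_empty)
      obtain ⟨x, -⟩ := (ne_univ_iff_exists_notMem U').mp fun h' => h.univ_notMem (h' ▸ hU')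
      exact ⟨x, fun h' => absurd h' hU⟩
  choose x hx using hx
  obtain ⟨U, hU, hBU⟩ := h.exists_subset (B ∪ x '' F)
    (bornSets_union hB (bornSets_finite (hF.image x)))
  exact ⟨U, hU, fun hUF => hx U hUF (hBU (Or.inr ⟨U, hUF, rfl⟩)), fun y hy => hBU (Or.inl hy)⟩

/-- Under the indexed selection property every countable `𝔅`-cover is groupable. -/
lemma GroupedSelection.mem_groupableCovers (hc : HasCompactBase 𝔅) (hP : GroupedSelection 𝔅)
    {𝒰 : Set (Set X)} (h : IsBornCover 𝔅 𝒰) (hcount : 𝒰.Countable) :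
    𝒰 ∈ groupableCovers 𝔅 := by
  obtain ⟨e, he⟩ := countable_iff_exists_injOn.mp hcount
  obtain ⟨b, I, hb, hfin, hdisj, hI⟩ := hP (fun m => {U ∈ 𝒰 | m ≤ e U}) (by
    intro m
    refine ⟨fun U hU => h.isOpen U hU.1, fun hU => h.univ_notMem hU.1, fun B hB => ?_⟩
    have hF : {U ∈ 𝒰 | e U < m}.Finite := by
      refine Set.Finite.of_finite_image ((Set.finite_lt_nat m).subset ?_)
        (he.mono (sep_subset _ _))
      rintro _ ⟨U, hU, rfl⟩
      exact hU.2
    obtain ⟨U, hU, hUF, hBU⟩ := h.exists_subset_notMem hF (sep_subset _ _) hB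
    exact ⟨U, ⟨hU, not_lt.mp fun hlt => hUF ⟨hU, hlt⟩⟩, hBU⟩)
  obtain ⟨W, s, hs, hWfin, hWdisj, hWU, hW⟩ :=
    exists_regrouping he (fun m => (hb m).1) (fun m => (hb m).2) hfin hdisj
  refine ⟨⟨h.isOpen, sUnion_eq_univ_of_bornSets h.exists_subset⟩, W, hWfin, hWdisj, hWU, ?_⟩
  intro B hB
  obtain ⟨K, hK, hKc, hBK⟩ := hc.exists_isCompact hB
  obtain ⟨n₀, hn₀⟩ := eventually_atTop.mp (hs.tendsto_atTop.eventually (hI K hK))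
  refine ⟨n₀, fun n hn => ?_⟩
  obtain ⟨m, hm, hKb⟩ := hn₀ n hn
  obtain ⟨δ, hδ, hδ'⟩ := hKc.exists_thickening_subset_open (h.isOpen _ (hb m).1) hKb
  exact ⟨b m, hW n ⟨m, hm, rfl⟩, δ, hδ, (Metric.thickening_subset_of_subset δ hBK).trans hδ'⟩

/-- The Gerlits–Nagy property is the indexed selection property. -/
lemma hasGerlitsNagy_iff (hc : HasCompactBase 𝔅) :
    HasGerlitsNagy X 𝔅 ↔ GroupedSelection 𝔅 := by
  constructor
  · intro h 𝒰 h𝒰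
    obtain ⟨b, hb, -, W, hfin, hdisj, hW, hB⟩ :=
      h 𝒰 fun m => (mem_openStrongCovers_iff hc).mpr (h𝒰 m)
    obtain ⟨I, hIfin, hIdisj, hIW⟩ := exists_index_groups (b := b) hfin hdisj
      fun n => hW ▸ subset_iUnion W n
    refine ⟨b, I, hb, hIfin, hIdisj, fun B hB' => ?_⟩
    obtain ⟨n₀, hn₀⟩ := hB B hB'
    filter_upwards [eventually_ge_atTop n₀] with n hn
    obtain ⟨U, hU, δ, hδ, hBU⟩ := hn₀ n hn
    rw [← hIW n] at hU
    obtain ⟨m, hm, rfl⟩ := hU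
    exact ⟨m, hm, (Metric.self_subset_thickening hδ B).trans hBU⟩
  · intro h 𝒰 h𝒰
    have h𝒰' := fun m => (mem_openStrongCovers_iff hc).mp (h𝒰 m)
    obtain ⟨b, I, hb, -, -, hB⟩ := h 𝒰 h𝒰'
    refine ⟨b, hb, h.mem_groupableCovers hc ⟨?_, ?_, ?_⟩ (countable_range b)⟩
    · rintro _ ⟨m, rfl⟩
      exact (h𝒰' m).isOpen _ (hb m)
    · rintro ⟨m, hm⟩
      exact (h𝒰' m).univ_notMem (hm ▸ hb m)
    · intro B hB'
      obtain ⟨n, m, -, hm⟩ := (hB B hB').exists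
      exact ⟨b m, ⟨m, rfl⟩, hm⟩

end Covers

/-! ### Finite powers -/

section Powers

variable {X : Type*} {𝔅 : Bornology X} {n : ℕ}

lemma mem_bornSets_powBornology {S : Set (Fin n → X)} :
    S ∈ bornSets (powBornology 𝔅 n) ↔ ∃ B ∈ bornSets 𝔅, S ⊆ cube n B := by
  change Sᶜᶜ ∈ {S | ∃ B ∈ bornSets 𝔅, S ⊆ cube n B} ↔ _
  rw [compl_compl, mem_ofPred_eq]

lemma HasCompactBase.powBornology [TopologicalSpace X] (hc : HasCompactBase 𝔅) :
    HasCompactBase (powBornology 𝔅 n) := by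
  refine ⟨{S | ∃ K ∈ bornSets 𝔅, IsCompact K ∧ S = cube n K}, ⟨?_, ?_⟩, ?_⟩
  · rintro _ ⟨K, hK, -, rfl⟩
    exact mem_bornSets_powBornology.mpr ⟨K, hK, Subset.rfl⟩
  · intro S hS
    obtain ⟨B, hB, hSB⟩ := mem_bornSets_powBornology.mp hS
    obtain ⟨K, hK, hKc, hBK⟩ := hc.exists_isCompact hB
    exact ⟨_, ⟨K, hK, hKc, rfl⟩, fun x hx i => hBK (hSB hx i)⟩
  · rintro _ ⟨K, -, hKc, rfl⟩
    exact isCompact_pi_infinite fun _ => hKc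

/-- The tube lemma for the cubes of a finite power. In the maximum metric, a thickening of `K^n` is the
cube of a thickening of `K`. -/
lemma IsCompact.exists_isOpen_cube_subset [MetricSpace X] {K : Set X} (hK : IsCompact K)
    {U : Set (Fin n → X)} (hU : IsOpen U) (hKU : cube n K ⊆ U) :
    ∃ V, IsOpen V ∧ K ⊆ V ∧ cube n V ⊆ U := by
  have hKn : IsCompact (cube n K) := isCompact_pi_infinite fun _ => hK
  obtain ⟨δ, hδ, h⟩ := hKn.exists_thickening_subset_open hU hKU
  refine ⟨Metric.thickening δ K, Metric.isOpen_thickening, Metric.self_subset_thickening hδ K,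
    fun x hx => h (Metric.mem_thickening_iff.mpr ?_)⟩
  choose y hyK hy using fun i => Metric.mem_thickening_iff.mp (hx i)
  exact ⟨y, hyK, (dist_pi_lt_iff hδ).mpr hy⟩

/-- The indexed selection property passes to finite powers. -/
lemma GroupedSelection.pow [MetricSpace X] (hc : HasCompactBase 𝔅) (h : GroupedSelection 𝔅)
    (n : ℕ) : GroupedSelection (powBornology 𝔅 n) := by
  intro 𝒰 h𝒰
  obtain ⟨V, I, hV, hfin, hdisj, hI⟩ :=
    h (fun m => {V | IsOpen V ∧ ∃ U ∈ 𝒰 m, cube n V ⊆ U}) (by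
      refine fun m => ⟨fun V hV => hV.1, ?_, fun B hB => ?_⟩
      · rintro ⟨-, U, hU, hVU⟩
        exact (h𝒰 m).univ_notMem
          (eq_univ_of_univ_subset (s := U) (fun x _ => hVU fun _ => mem_univ _) ▸ hU)
      · obtain ⟨K, hK, hKc, hBK⟩ := hc.exists_isCompact hB
        obtain ⟨U, hU, hKU⟩ := (h𝒰 m).exists_subset (cube n K)
          (mem_bornSets_powBornology.mpr ⟨K, hK, Subset.rfl⟩)
        obtain ⟨V, hVo, hKV, hVU⟩ := hKc.exists_isOpen_cube_subset ((h𝒰 m).isOpen U hU) hKU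
        exact ⟨V, ⟨hVo, U, hU, hVU⟩, hBK.trans hKV⟩)
  choose U hU hVU using fun m => (hV m).2
  refine ⟨U, I, hU, hfin, hdisj, fun S hS => ?_⟩
  obtain ⟨B, hB, hSB⟩ := mem_bornSets_powBornology.mp hS
  filter_upwards [hI B hB] with k ⟨m, hm, hBV⟩
  exact ⟨m, hm, fun x hx => hVU m fun i => hBV (hSB hx i)⟩

/-- The indexed selection property of `X^1` is that of `X`. -/
lemma GroupedSelection.of_pow_one [TopologicalSpace X]
    (h : GroupedSelection (powBornology 𝔅 1)) : GroupedSelection 𝔅 := by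
  intro 𝒰 h𝒰
  obtain ⟨V, I, hV, hfin, hdisj, hI⟩ := h (fun m => (cube 1) '' 𝒰 m) (by
    refine fun m => ⟨?_, ?_, fun S hS => ?_⟩
    · rintro _ ⟨U, hU, rfl⟩
      have : cube 1 U = (fun x : Fin 1 → X => x 0) ⁻¹' U := by
        ext x
        simp [cube]
      rw [this]
      exact ((h𝒰 m).isOpen U hU).preimage (continuous_apply 0)
    · rintro ⟨U, hU, hU'⟩
      have : U = univ := eq_univ_of_forall fun x =>
        (hU' ▸ mem_univ (fun _ => x) : (fun _ => x) ∈ cube 1 U) 0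
      exact (h𝒰 m).univ_notMem (this ▸ hU)
    · obtain ⟨B, hB, hSB⟩ := mem_bornSets_powBornology.mp hS
      obtain ⟨U, hU, hBU⟩ := (h𝒰 m).exists_subset B hB
      exact ⟨_, ⟨U, hU, rfl⟩, fun x hx i => hBU (hSB hx i)⟩)
  choose U hU hUV using hV
  refine ⟨U, I, hU, hfin, hdisj, fun B hB => ?_⟩
  filter_upwards [hI (cube 1 B) (mem_bornSets_powBornology.mpr ⟨B, hB, Subset.rfl⟩)]
    with k ⟨m, hm, hBV⟩
  rw [← hUV m] at hBV
  exact ⟨m, hm, fun x hx => hBV (a := fun _ => x) (fun _ => hx) 0⟩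

end Powers

/-! ### The space of continuous functions -/

section StrongC

variable {X : Type*} [MetricSpace X] {𝔅 : Bornology X}

/-- The underlying function of an element of `C(X)`. -/
def StrongC.eval (f : StrongC 𝔅) : X → ℝ := DFunLike.coe (F := C(X, ℝ)) f

lemma StrongC.continuous_eval (f : StrongC 𝔅) : Continuous f.eval :=
  ContinuousMap.continuous (X := X) (Y := ℝ) f

lemma StrongC.isOpen_dist_lt (f g : StrongC 𝔅) (ε : ℝ) :
    IsOpen {x | dist (f.eval x) (g.eval x) < ε} :=
  isOpen_lt (f.continuous_eval.dist g.continuous_eval) continuous_const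

/-- If `𝔅` has a compact base, then `τ^s_𝔅` is the topology of uniform convergence on the members
of `𝔅`. -/
lemma StrongC.mem_nhds_iff (hc : HasCompactBase 𝔅) {y : StrongC 𝔅} {W : Set (StrongC 𝔅)} :
    W ∈ 𝓝 y ↔ ∃ B ∈ bornSets 𝔅, ∃ ε : ℝ, 0 < ε ∧
      ∀ f : StrongC 𝔅, (∀ x ∈ B, dist (y.eval x) (f.eval x) < ε) → f ∈ W := by
  have hbasis : W ∈ 𝓝 y ↔ ∃ B ∈ bornSets 𝔅, ∃ ε : ℝ, 0 < ε ∧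
      ∀ f : StrongC 𝔅, (y.eval, f.eval) ∈ strongEntourage B ε → f ∈ W := by
    rw [show 𝓝 y = comap StrongC.eval (@nhds _ (strongUniformSpace ℝ 𝔅).toTopologicalSpace y.eval)
      from @nhds_induced _ _ (strongUniformSpace ℝ 𝔅).toTopologicalSpace _ _,
      @nhds_eq_comap_uniformity _ (strongUniformSpace ℝ 𝔅), comap_comap, mem_comap]
    constructor
    · rintro ⟨E, hE, hEW⟩
      obtain ⟨_, ⟨B, hB, ε, hε, rfl⟩, hBE⟩ := (strongBasis ℝ 𝔅).mem_filter_iff.mp hE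
      exact ⟨B, hB, ε, hε, fun f hf => hEW (hBE hf)⟩
    · rintro ⟨B, hB, ε, hε, h⟩
      exact ⟨strongEntourage B ε, (strongBasis ℝ 𝔅).mem_filter_iff.mpr
        ⟨_, ⟨B, hB, ε, hε, rfl⟩, Subset.rfl⟩, fun f hf => h f hf⟩
  rw [hbasis]
  constructor
  · rintro ⟨B, hB, ε, hε, h⟩
    obtain ⟨K, hK, hKc, hBK⟩ := hc.exists_isCompact hB
    refine ⟨K, hK, ε, hε, fun f hf => h f ?_⟩
    obtain ⟨δ, hδ, hKδ⟩ := hKc.exists_thickening_subset_open (y.isOpen_dist_lt f ε) hf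
    exact ⟨δ, hδ, fun x hx => hKδ (Metric.thickening_subset_of_subset δ hBK hx)⟩
  · rintro ⟨B, hB, ε, hε, h⟩
    refine ⟨B, hB, ε, hε, fun f hf => h f ?_⟩
    obtain ⟨δ, hδ, hf⟩ := hf
    exact fun x hx => hf x (Metric.self_subset_thickening hδ B hx)

lemma StrongC.mem_closure_iff (hc : HasCompactBase 𝔅) {y : StrongC 𝔅} {A : Set (StrongC 𝔅)} :
    y ∈ closure A ↔ ∀ B ∈ bornSets 𝔅, ∀ ε : ℝ, 0 < ε →
      ∃ f ∈ A, ∀ x ∈ B, dist (y.eval x) (f.eval x) < ε := by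
  rw [mem_closure_iff_nhds]
  constructor
  · intro h B hB ε hε
    obtain ⟨f, hf, hfA⟩ := h {f | ∀ x ∈ B, dist (y.eval x) (f.eval x) < ε}
      ((mem_nhds_iff hc).mpr ⟨B, hB, ε, hε, fun f hf => hf⟩)
    exact ⟨f, hfA, hf⟩
  · intro h W hW
    obtain ⟨B, hB, ε, hε, hBW⟩ := (mem_nhds_iff hc).mp hW
    obtain ⟨f, hfA, hf⟩ := h B hB ε hε
    exact ⟨f, hBW f hf, hfA⟩

/-- Finitely many functions can be deleted from a set that clusters at `y`. -/
lemma StrongC.exists_mem_notMem (hc : HasCompactBase 𝔅) {y : StrongC 𝔅} {A F : Set (StrongC 𝔅)}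
    (hA : A ∈ OmegaAt y) (hF : F.Finite) (hFA : F ⊆ A) {B : Set X} (hB : B ∈ bornSets 𝔅) {ε : ℝ}
    (hε : 0 < ε) : ∃ f ∈ A, f ∉ F ∧ ∀ x ∈ B, dist (y.eval x) (f.eval x) < ε := by
  have hy : y ∈ closure (A \ F) := by
    have h : y ∈ closure (A \ F) ∪ closure F := by
      rw [← closure_union, sdiff_union_of_subset hFA]
      exact hA.1
    refine h.resolve_right fun hyF => ?_
    -- A finite set is closed: uniform convergence on singletons separates functions.
    obtain ⟨f, hf, hyf⟩ : ∃ f ∈ F, y ∈ closure {f} := by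
      rw [← biUnion_of_singleton F, hF.closure_biUnion] at hyF
      simpa using hyF
    refine hA.2 (?_ : y ∈ A)
    have hfy : f = y := by
      refine ContinuousMap.ext (X := X) (Y := ℝ) fun x => ?_
      by_contra hne
      obtain ⟨g, rfl, hg⟩ := (mem_closure_iff hc).mp hyf {x} (bornSets_finite (finite_singleton x))
        (dist (y.eval x) (f.eval x)) (dist_pos.mpr fun h' => hne h'.symm)
      exact (hg x rfl).false
    exact hfy ▸ hFA hf
  obtain ⟨f, hf, h⟩ := (mem_closure_iff hc).mp hy B hB ε hε
  exact ⟨f, hf.1, hf.2, h⟩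

/-- The `𝔅`-cover by the proper open sets on which some `f ∈ A` is `ε`-close to `y`. If `f` is
close to `y` everywhere, a point outside `B` is removed from the whole space. -/
lemma StrongC.isBornCover_close (hX : univ ∉ bornSets 𝔅) {y : StrongC 𝔅}
    {A : Set (StrongC 𝔅)} {ε : ℝ}
    (hA : ∀ B ∈ bornSets 𝔅, ∃ f ∈ A, ∀ x ∈ B, dist (y.eval x) (f.eval x) < ε) :
    IsBornCover 𝔅 {U | IsOpen U ∧ U ≠ univ ∧
      ∃ f ∈ A, ∀ x ∈ U, dist (y.eval x) (f.eval x) < ε} := by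
  refine ⟨fun U hU => hU.1, fun h => h.2.1 rfl, fun B hB => ?_⟩
  obtain ⟨f, hf, hBf⟩ := hA B hB
  obtain ⟨p, hp⟩ := exists_notMem_of_mem_bornSets hX hB
  refine ⟨{x | dist (y.eval x) (f.eval x) < ε} \ {p},
    ⟨(y.isOpen_dist_lt f ε).sdiff isClosed_singleton, ?_, f, hf, fun x hx => hx.1⟩, ?_⟩
  · exact (ne_univ_iff_exists_notMem _).mpr ⟨p, fun h => h.2 rfl⟩
  · exact fun x hx => ⟨hBf x hx, fun h => hp (h ▸ hx)⟩

lemma GroupedSelection.hasCountableStrongFanTightness (hX : univ ∉ bornSets 𝔅)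
    (hc : HasCompactBase 𝔅) (h : GroupedSelection 𝔅) :
    HasCountableStrongFanTightness (StrongC 𝔅) := by
  intro y A hA
  obtain ⟨U, I, hU, hfin, hdisj, hI⟩ := h
    (fun m => {U | IsOpen U ∧ U ≠ univ ∧
      ∃ f ∈ A m, ∀ x ∈ U, dist (y.eval x) (f.eval x) < 1 / ((m : ℝ) + 1)})
    fun m => StrongC.isBornCover_close hX fun B hB =>
      (StrongC.mem_closure_iff hc).mp (hA m).1 B hB _ Nat.one_div_pos_of_nat
  choose f hf hUf using fun m => (hU m).2.2
  refine ⟨f, hf, (StrongC.mem_closure_iff hc).mpr fun B hB ε hε => ?_, ?_⟩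
  · obtain ⟨N, hN⟩ := exists_nat_one_div_lt hε
    obtain ⟨n, ⟨m, hm, hBm⟩, hn⟩ :=
      ((hI B hB).and (eventually_forall_le_of_disjoint hdisj N)).exists
    exact ⟨f m, ⟨m, rfl⟩, fun x hx => (hUf m x (hBm hx)).trans
      ((Nat.one_div_le_one_div (hn m hm)).trans_lt hN)⟩
  · rintro ⟨m, hm⟩
    exact (hA m).2 (hm ▸ hf m)

lemma GroupedSelection.hasReznichenko (hX : univ ∉ bornSets 𝔅) (hc : HasCompactBase 𝔅)
    (h : GroupedSelection 𝔅) : HasReznichenko (StrongC 𝔅) := by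
  intro y A hA hcount
  obtain ⟨e, he⟩ := countable_iff_exists_injOn.mp hcount
  obtain ⟨U, I, hU, hfin, hdisj, hI⟩ := h
    (fun m => {U | IsOpen U ∧ U ≠ univ ∧
      ∃ f ∈ {f ∈ A | m ≤ e f}, ∀ x ∈ U, dist (y.eval x) (f.eval x) < 1 / ((m : ℝ) + 1)})
    (by
      refine fun m => StrongC.isBornCover_close hX fun B hB => ?_
      have hF : {f ∈ A | e f < m}.Finite := by
        refine Set.Finite.of_finite_image ((Set.finite_lt_nat m).subset ?_)
          (he.mono (sep_subset _ _))
        rintro _ ⟨f, hf, rfl⟩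
        exact hf.2
      obtain ⟨f, hf, hfF, hBf⟩ :=
        StrongC.exists_mem_notMem hc hA hF (sep_subset _ _) hB (Nat.one_div_pos_of_nat (n := m))
      exact ⟨f, ⟨hf, not_lt.mp fun hlt => hfF ⟨hf, hlt⟩⟩, hBf⟩)
  choose f hf hUf using fun m => (hU m).2.2
  obtain ⟨P, s, hs, hPfin, hPdisj, hPA, hP⟩ :=
    exists_regrouping he (fun m => (hf m).1) (fun m => (hf m).2) hfin hdisj
  refine ⟨P, hPfin, hPdisj, hPA, fun W hW => eventually_atTop.mp ?_⟩
  obtain ⟨B, hB, ε, hε, hBW⟩ := (StrongC.mem_nhds_iff hc).mp hW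
  obtain ⟨N, hN⟩ := exists_nat_one_div_lt hε
  filter_upwards [hs.tendsto_atTop.eventually
    ((hI B hB).and (eventually_forall_le_of_disjoint hdisj N))] with n ⟨⟨m, hm, hBm⟩, hn⟩
  exact ⟨f m, hBW _ fun x hx => (hUf m x (hBm hx)).trans
    ((Nat.one_div_le_one_div (hn m hm)).trans_lt hN), hP n ⟨m, hm, rfl⟩⟩

/-- The functions that are far from `0` outside a member of a `𝔅`-cover cluster at `0`. -/
lemma IsBornCover.mem_omegaAt (hc : HasCompactBase 𝔅) {𝒰 : Set (Set X)} (h : IsBornCover 𝔅 𝒰)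
    {y : StrongC 𝔅} (hy : ∀ x, y.eval x = 0) :
    {f : StrongC 𝔅 | ∃ U ∈ 𝒰, ∀ x ∉ U, 1 ≤ dist (y.eval x) (f.eval x)} ∈ OmegaAt y := by
  refine ⟨(StrongC.mem_closure_iff hc).mpr fun B hB ε hε => ?_, ?_⟩
  · obtain ⟨K, hK, hKc, hBK⟩ := hc.exists_isCompact hB
    obtain ⟨U, hU, hKU⟩ := h.exists_subset K hK
    obtain ⟨f, hf0, hf1, -⟩ := exists_continuous_zero_one_of_isClosed hKc.isClosed
      (h.isOpen U hU).isClosed_compl (disjoint_compl_right_iff_subset.mpr hKU)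
    refine ⟨f, ⟨U, hU, fun x hx => ?_⟩, fun x hx => ?_⟩
    · have h1 : StrongC.eval (𝔅 := 𝔅) f x = 1 := hf1 hx
      simp [hy, h1]
    · have h0 : StrongC.eval (𝔅 := 𝔅) f x = 0 := hf0 (hBK hx)
      simpa [hy, h0] using hε
  · rintro ⟨U, hU, hyU⟩
    refine h.univ_notMem ((eq_univ_of_forall fun x => ?_ : U = univ) ▸ hU)
    by_contra hx
    have := hyU x hx
    rw [dist_self] at this
    exact absurd this (by norm_num)

lemma GroupedSelection.of_strongC (hc : HasCompactBase 𝔅)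
    (h1 : HasCountableStrongFanTightness (StrongC 𝔅)) (h2 : HasReznichenko (StrongC 𝔅)) :
    GroupedSelection 𝔅 := by
  intro 𝒰 h𝒰
  let y : StrongC 𝔅 := ContinuousMap.const X (0 : ℝ)
  obtain ⟨f, hf, hfy⟩ := h1 y _ fun m => (h𝒰 m).mem_omegaAt hc (y := y) fun _ => rfl
  obtain ⟨P, hfin, hdisj, hP, hPW⟩ := h2 y _ hfy (countable_range f)
  obtain ⟨I, hIfin, hIdisj, hIP⟩ := exists_index_groups (b := f) hfin hdisj
    fun n => hP ▸ subset_iUnion P n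
  choose U hU hUf using hf
  refine ⟨U, I, hU, hIfin, hIdisj, fun B hB => ?_⟩
  obtain ⟨n₀, hn₀⟩ := hPW {g | ∀ x ∈ B, dist (y.eval x) (g.eval x) < 1}
    ((StrongC.mem_nhds_iff hc).mpr ⟨B, hB, 1, one_pos, fun g hg => hg⟩)
  filter_upwards [eventually_ge_atTop n₀] with n hn
  obtain ⟨g, hgB, hgP⟩ := hn₀ n hn
  rw [← hIP n] at hgP
  obtain ⟨m, hm, rfl⟩ := hgP
  refine ⟨m, hm, fun x hx => ?_⟩
  by_contra hxU
  exact (hgB x hx).not_ge (hUf m x hxU)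

end StrongC

/-! ### The equivalence -/

theorem corollaryC3 {X : Type*} [MetricSpace X] (𝔅 : Bornology X)
    (hX : univ ∉ bornSets 𝔅) (hc : HasCompactBase 𝔅) :
    (∀ n : ℕ, 1 ≤ n → HasGerlitsNagy (Fin n → X) (powBornology 𝔅 n)) ↔
      (HasCountableStrongFanTightness (StrongC 𝔅) ∧ HasReznichenko (StrongC 𝔅)) := by
  constructor
  · intro h
    have hP : GroupedSelection 𝔅 :=
      ((hasGerlitsNagy_iff hc.powBornology).mp (h 1 le_rfl)).of_pow_one
    exact ⟨hP.hasCountableStrongFanTightness hX hc, hP.hasReznichenko hX hc⟩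
  · rintro ⟨h1, h2⟩ n -
    exact (hasGerlitsNagy_iff hc.powBornology).mpr
      ((GroupedSelection.of_strongC hc h1 h2).pow hc n)
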